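/- For every integer $t \ge 3$ there exists a constant $C$ (depending only on $t$) such that, for every natural number $n$, $$\mathrm{ex}(n, H_t) \le C\, n^{3/2 - 1/6^t},$$ where $H_t$ is the subdivision of the complete graph $K_t$, that is, the graph obtained from $K_t$ by replacing its edges with internally disjoint paths of length $2$, and $\mathrm{ex}(n, H)$ denotes the largest number of edges in a graph on $n$ vertices which contains no copy of $H$ as a (not necessarily induced) subgraph. -/

import Mathlib

namespace SimpleGraph

/-- The subdivision (1-subdivision) of a graph `G`: every edge of `G` is replaced by a path of
length two through a new vertex of its own. The vertices are those of `G` together with one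
subdividing vertex for each edge of `G`, and the subdividing vertex of an edge `e` is joined to
exactly the two endpoints of `e`. -/
def subdivision {V : Type*} (G : SimpleGraph V) : SimpleGraph (V ⊕ G.edgeSet) where
  Adj x y :=
    match x, y with
    | Sum.inl v, Sum.inr e => v ∈ (e : Sym2 V)
    | Sum.inr e, Sum.inl v => v ∈ (e : Sym2 V)
    | _, _ => False
  symm := ⟨by rintro (v | e) (w | f) h <;> exact h⟩
  loopless := ⟨by rintro (v | e) h <;> exact h⟩

end SimpleGraph

/-!
The proof gives the exponent `3/2 - ε` for every `0 ≤ ε ≤ 1/(24 t²)` and for the subdivision of any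
graph on `t ≥ 2` vertices; since `24 t² ≤ 6 ^ t` for `t ≥ 3`, the case `ε = 1 / 6 ^ t` is covered.

Removing a vertex of small degree and inducting on `n` (`exists_extremalNumber_le_rpow`) reduces the
bound to graphs `G` on `n` vertices, `n` large, of minimum degree at least `c n^(1/2-ε)`. To find the
subdivision, it suffices to find `t` branch vertices whose pairs can be given distinct common
neighbours outside the branch set; by Hall's theorem this is possible if all pairs have at least
`t²` common neighbours (`subdivision_isContained_of_card_le_codegree`).

Choose for every vertex `v` a set `N v` of exactly `δ ≈ c n^(1/2-ε)` neighbours, which fixes the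
total in-degree to be `n δ`. Let `H` be the set of vertices contained in more than
`D = n^(1-1/(2t))` of the sets `N v`; it is small. If at least half of the vertices send half of
`N v` into `H`, double counting gives `t` vertices of `H` with `t²` common neighbours
(`exists_powersetCard_le_card_superset`), and we are done.

Otherwise, put `M v = N v \ H` and let `A` be the set of at least `n/2` vertices with
`#(M v) ≥ δ/2`. Call a pair of vertices heavy if their sets `M` share at least `t²` elements, and
light if they share fewer, but at least one. A heavy `K_t` gives the subdivision. If there is none,
then by Turán's theorem a positive proportion of the pairs inside each in-neighbourhood is light, so
a Cauchy-Schwarz count shows that in every large `U ⊆ A` some vertex is light to a proportion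
`p = n^(-2ε)` of `U` (`exists_card_isLight_ge`). Branch vertices are now selected greedily
(`exists_isSpread`): restrict the current candidate set to the light partners of the new branch
vertex, and delete the few candidates which are adjacent to it or which contain a common element of
its set `M` and that of a previous branch vertex. Since every vertex lies in at most `D` sets `M v`
with `v ∈ A`, the deletion costs `O(D)`, far less than the `n p^t` candidates that are left. In the
end the sets `M x ∩ M y` are nonempty and pairwise disjoint, and they supply the subdividing
vertices.
-/

open Finset

namespace SimpleGraph

/-! ### Building copies of a subdivision -/

theorem subdivision_isContained {V W : Type*} {G : SimpleGraph V} {K : SimpleGraph W}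
    (u : W → V) (y : K.edgeSet → V) (hu : Function.Injective u) (hy : Function.Injective y)
    (hne : ∀ w e, u w ≠ y e) (hadj : ∀ w (e : K.edgeSet), w ∈ (e : Sym2 W) → G.Adj (u w) (y e)) :
    K.subdivision ⊑ G := by
  refine ⟨⟨⟨Sum.elim u y, ?_⟩, ?_⟩⟩
  · rintro (v | e) (w | f) h
    · exact h.elim
    · exact hadj v f h
    · exact (hadj w e h).symm
    · exact h.elim
  · exact hu.sumElim hy hne

/-- If all pairs of the injectively chosen branch vertices have at least `t²` common neighbours,
with `t` the number of branch vertices, then Hall's condition holds for the common neighbours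
outside the branch set: `t² - t` is at least the number of pairs. -/
theorem subdivision_isContained_of_card_le_codegree {V W : Type*} [Fintype V] [DecidableEq V]
    [Fintype W] {G : SimpleGraph V} [DecidableRel G.Adj] (K : SimpleGraph W) (u : W → V)
    (hu : Function.Injective u)
    (hcod : ∀ i j, i ≠ j → Fintype.card W ^ 2 ≤ #{b | G.Adj (u i) b ∧ G.Adj (u j) b}) :
    K.subdivision ⊑ G := by
  classical
  let F : K.edgeSet → Finset V := fun e ↦
    univ.filter (fun b ↦ ∀ w ∈ (e : Sym2 W), G.Adj (u w) b) \ univ.image u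
  have hF : ∀ e, #(univ : Finset K.edgeSet) ≤ #(F e) := by
    rintro ⟨e, he⟩
    induction e with | _ i j =>
    have hij : i ≠ j := K.ne_of_adj he
    have h1 := hcod i j hij
    have h3 : #(univ.image u) ≤ Fintype.card W := card_image_le
    have h4 := le_card_sdiff (univ.image u) ({b | G.Adj (u i) b ∧ G.Adj (u j) b} : Finset V)
    have h5 : #(univ : Finset K.edgeSet) ≤ (Fintype.card W).choose 2 := by
      have := K.card_edgeFinset_le_card_choose_two
      rwa [edgeFinset_card] at this
    have h6 : (Fintype.card W).choose 2 + Fintype.card W ≤ Fintype.card W ^ 2 := by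
      rw [Nat.choose_two_right]
      rcases Fintype.card W with - | k
      · simp
      · have : (k + 1) * (k + 1 - 1) / 2 ≤ (k + 1) * k := Nat.div_le_self _ _
        nlinarith
    have h2 : #(F ⟨s(i, j), he⟩)
        = #(({b | G.Adj (u i) b ∧ G.Adj (u j) b} : Finset V) \ univ.image u) := by
      simp [F]
    rw [h2]
    omega
  obtain ⟨y, hy, hyF⟩ := (Finset.all_card_le_biUnion_card_iff_exists_injective F).1 (by
    intro s
    rcases s.eq_empty_or_nonempty with rfl | ⟨e, he⟩
    · simp
    · exact (card_le_card (subset_univ s)).trans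
        ((hF e).trans (card_le_card (subset_biUnion_of_mem F he))))
  refine subdivision_isContained u y hu hy ?_ ?_
  · intro w e h
    have := (mem_sdiff.1 (hyF e)).2
    exact this (mem_image.2 ⟨w, mem_univ _, h⟩)
  · intro w e hw
    exact (mem_filter.1 (mem_sdiff.1 (hyF e)).1).2 w hw

/-! ### Two counting lemmas -/

/-- Turán's theorem for the vertices in `s`, counting ordered non-adjacent pairs, diagonal
included. -/
theorem CliqueFree.sq_card_le_mul_card_not_adj {V : Type*} [DecidableEq V] {H : SimpleGraph V}
    [DecidableRel H.Adj] {r : ℕ} (hr : 0 < r) (cf : H.CliqueFree (r + 1)) (s : Finset V) :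
    #s ^ 2 ≤ r * #{p ∈ s ×ˢ s | ¬ H.Adj p.1 p.2} := by
  classical
  let K : SimpleGraph s := H.comap (Function.Embedding.subtype _)
  have hK : K.CliqueFree (r + 1) := cf.comap ⟨(Embedding.comap _ H).toCopy⟩
  have h1 : #K.edgeFinset ≤ #(turanGraph (#s) r).edgeFinset := by
    obtain ⟨T, _, maxT⟩ := exists_isTuranMaximal (V := s) hr
    have := ((isTuranMaximal_iff_nonempty_iso_turanGraph hr).mp maxT).some.card_edgeFinset_eq
    rw [Fintype.card_coe] at this
    rw [← this]
    exact maxT.2 hK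
  have h2 := mul_card_edgeFinset_turanGraph_le (n := #s) (r := r)
  have h3 : 2 * #K.edgeFinset = #{p ∈ s ×ˢ s | H.Adj p.1 p.2} := by
    rw [two_mul_card_edgeFinset]
    refine card_bij (fun p _ ↦ (p.1.1, p.2.1)) ?_ ?_ ?_
    · rintro ⟨x, y⟩ h
      simpa [K] using h
    · rintro ⟨x, y⟩ - ⟨x', y'⟩ - h
      exact Prod.ext (Subtype.ext (congrArg Prod.fst h)) (Subtype.ext (congrArg Prod.snd h))
    · rintro ⟨x, y⟩ h
      simp only [mem_filter, mem_product] at h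
      exact ⟨(⟨x, h.1.1⟩, ⟨y, h.1.2⟩), by simpa [K] using h.2, rfl⟩
  have h4 := card_filter_add_card_filter_not (s := s ×ˢ s) (fun p ↦ H.Adj p.1 p.2)
  rw [card_product] at h4
  obtain ⟨k, rfl⟩ : ∃ k, r = k + 1 := ⟨r - 1, by omega⟩
  simp only [Nat.add_sub_cancel] at h2
  nlinarith

/-- One-sided Kővári–Sós–Turán double counting: pairs `(b, T)` with `T` a `t`-subset of `N b ∩ H`. -/
theorem exists_powersetCard_le_card_superset {V : Type*} [DecidableEq V]
    (N : V → Finset V) (B H : Finset V) {k m t : ℕ} (hB : ∀ b ∈ B, k ≤ #(N b ∩ H))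
    (h : m * #H ^ t < #B * (k + 1 - t) ^ t) :
    ∃ T ⊆ H, #T = t ∧ m ≤ #{b ∈ B | T ⊆ N b} := by
  by_contra! hcon
  have h1 := sum_card_bipartiteAbove_eq_sum_card_bipartiteBelow (s := B) (t := H.powersetCard t)
    (fun b T ↦ T ⊆ N b)
  have h2 : #B * k.choose t ≤ ∑ b ∈ B, #((H.powersetCard t).bipartiteAbove (fun b T ↦ T ⊆ N b) b) := by
    rw [← smul_eq_mul]
    refine card_nsmul_le_sum _ _ _ fun b hb ↦ ?_
    calc k.choose t ≤ (#(N b ∩ H)).choose t := Nat.choose_le_choose _ (hB b hb)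
      _ = #((N b ∩ H).powersetCard t) := (card_powersetCard _ _).symm
      _ ≤ _ := by
        refine card_le_card fun T hT ↦ ?_
        rw [mem_powersetCard, subset_inter_iff] at hT
        simp [bipartiteAbove, mem_powersetCard, hT]
  have h3 : ∑ T ∈ H.powersetCard t, #(B.bipartiteBelow (fun b T ↦ T ⊆ N b) T)
      ≤ (#H).choose t * m := by
    rw [← smul_eq_mul, ← card_powersetCard]
    refine sum_le_card_nsmul _ _ _ fun T hT ↦ ?_
    rw [mem_powersetCard] at hT
    exact (hcon T hT.1 hT.2).le
  have h4 : #B * k.choose t ≤ (#H).choose t * m := h2.trans (h1.le.trans h3)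
  refine h.not_ge ?_
  calc #B * (k + 1 - t) ^ t ≤ #B * k.descFactorial t := by
        gcongr; exact Nat.pow_sub_le_descFactorial k t
    _ = t.factorial * (#B * k.choose t) := by rw [Nat.descFactorial_eq_factorial_mul_choose]; ring
    _ ≤ t.factorial * ((#H).choose t * m) := by gcongr
    _ = m * (#H).descFactorial t := by rw [Nat.descFactorial_eq_factorial_mul_choose]; ring
    _ ≤ m * #H ^ t := by gcongr; exact Nat.descFactorial_le_pow _ _

/-! ### Light pairs -/

/-- The graph of heavy pairs: `x` and `y` are adjacent if `M x` and `M y` have at least `m` common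
elements. -/
def codegreeGraph {V : Type*} [DecidableEq V] (M : V → Finset V) (m : ℕ) : SimpleGraph V where
  Adj x y := x ≠ y ∧ m ≤ #(M x ∩ M y)
  symm := ⟨fun _ _ h ↦ ⟨h.1.symm, inter_comm (M _) _ ▸ h.2⟩⟩
  loopless := ⟨fun _ h ↦ h.1 rfl⟩

/-- A pair of distinct vertices is light if `M x` and `M y` have at least one, but fewer than `m`,
common elements. -/
def IsLight {V : Type*} [DecidableEq V] (M : V → Finset V) (m : ℕ) (x y : V) : Prop :=
  x ≠ y ∧ (M x ∩ M y).Nonempty ∧ #(M x ∩ M y) < m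

theorem IsLight.symm {V : Type*} [DecidableEq V] {M : V → Finset V} {m : ℕ} {x y : V}
    (h : IsLight M m x y) : IsLight M m y x :=
  ⟨h.1.symm, inter_comm (M x) (M y) ▸ h.2⟩

open Classical in
/-- Turán's theorem applied in each set `{u ∈ U | b ∈ M u}`; two members of it form a heavy pair, a
light pair or a diagonal pair, and a light pair is counted for fewer than `m` elements `b`. -/
theorem sum_sq_card_filter_mem_le {V : Type*} [Fintype V] (M : V → Finset V)
    {m r : ℕ} (hr : 0 < r) (cf : (codegreeGraph M m).CliqueFree (r + 1)) (U : Finset V) :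
    ∑ b, #{u ∈ U | b ∈ M u} ^ 2
      ≤ r * (∑ b, #{u ∈ U | b ∈ M u} + m * #{p ∈ U ×ˢ U | IsLight M m p.1 p.2}) := by
  have h1 : ∀ b, #{u ∈ U | b ∈ M u} ^ 2 ≤ r * (#{u ∈ U | b ∈ M u} +
      #{p ∈ {p ∈ U ×ˢ U | IsLight M m p.1 p.2} | b ∈ M p.1 ∩ M p.2}) := by
    intro b
    refine (cf.sq_card_le_mul_card_not_adj hr {u ∈ U | b ∈ M u}).trans ?_
    gcongr
    rw [← diag_card {u ∈ U | b ∈ M u}]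
    refine (card_le_card ?_).trans (card_union_le _ _)
    rintro ⟨x, y⟩ h
    simp only [mem_filter, mem_product, codegreeGraph, not_and, not_le] at h
    by_cases hxy : x = y
    · subst hxy
      exact mem_union_left _ (by simpa using h.1.1)
    · refine mem_union_right _ ?_
      have hb : b ∈ M x ∩ M y := mem_inter.2 ⟨h.1.1.2, h.1.2.2⟩
      simp only [mem_filter, mem_product]
      exact ⟨⟨⟨h.1.1.1, h.1.2.1⟩, hxy, ⟨b, hb⟩, h.2 hxy⟩, hb⟩
  refine (sum_le_sum fun b _ ↦ h1 b).trans ?_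
  rw [← mul_sum, sum_add_distrib]
  gcongr
  have h2 := sum_card_bipartiteAbove_eq_sum_card_bipartiteBelow (s := (univ : Finset V))
    (t := {p ∈ U ×ˢ U | IsLight M m p.1 p.2}) (fun b p ↦ b ∈ M p.1 ∩ M p.2)
  simp only [bipartiteAbove, bipartiteBelow] at h2
  rw [h2, mul_comm, ← smul_eq_mul]
  refine sum_le_card_nsmul _ _ _ fun p hp ↦ ?_
  rw [mem_filter] at hp
  rw [filter_univ_mem]
  exact hp.2.2.2.le

open Classical in
/-- If there is no heavy clique on `r + 1` vertices, then some vertex of a large set `U` forms light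
pairs with a fixed proportion of `U`. The assumption `hUd` makes the diagonal pairs negligible. -/
theorem exists_card_isLight_ge {V : Type*} [Fintype V] (M : V → Finset V)
    {m r : ℕ} (hr : 0 < r) (hm : 0 < m) (cf : (codegreeGraph M m).CliqueFree (r + 1))
    (U : Finset V) (hU : U.Nonempty) {d : ℝ} (hd : 0 ≤ d) (hM : ∀ u ∈ U, d ≤ #(M u))
    (hUd : 2 * Fintype.card V * r ≤ #U * d) :
    ∃ u ∈ U, #U * (d ^ 2 / (2 * Fintype.card V * r * m)) ≤ #{w ∈ U | IsLight M m u w} := by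
  set n : ℝ := (Fintype.card V : ℝ)
  have hn : 0 < n := by
    have : 0 < Fintype.card V := Fintype.card_pos_iff.2 ⟨hU.choose⟩
    exact Nat.cast_pos.2 this
  have hr' : (0 : ℝ) < r := by exact_mod_cast hr
  have hm' : (0 : ℝ) < m := by exact_mod_cast hm
  by_contra! hcon
  set S : ℝ := ∑ b, (#{u ∈ U | b ∈ M u} : ℝ)
  have hS : #U * d ≤ S := by
    have h2 := sum_card_bipartiteAbove_eq_sum_card_bipartiteBelow (s := U)
      (t := (univ : Finset V)) (fun u b ↦ b ∈ M u)
    simp only [bipartiteAbove, bipartiteBelow, filter_univ_mem] at h2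
    have h3 : S = ∑ u ∈ U, (#(M u) : ℝ) := by
      simp only [S]; exact_mod_cast h2.symm
    rw [h3, ← nsmul_eq_mul]
    exact card_nsmul_le_sum _ _ _ hM
  set P : ℝ := (#{p ∈ U ×ˢ U | IsLight M m p.1 p.2} : ℝ)
  have hP : P < #U * (#U * (d ^ 2 / (2 * n * r * m))) := by
    have h3 : P = ∑ u ∈ U, (#{w ∈ U | IsLight M m u w} : ℝ) := by
      simp only [P, card_filter, sum_product]
      push_cast; rfl
    rw [h3, ← nsmul_eq_mul, ← sum_const]
    exact sum_lt_sum_of_nonempty hU hcon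
  have h1 : S ^ 2 ≤ n * ∑ b, (#{u ∈ U | b ∈ M u} : ℝ) ^ 2 := by
    simpa [n] using sq_sum_le_card_mul_sum_sq (s := (univ : Finset V))
      (f := fun b ↦ (#{u ∈ U | b ∈ M u} : ℝ))
  have h2 : ∑ b, (#{u ∈ U | b ∈ M u} : ℝ) ^ 2 ≤ r * (S + m * P) := by
    have := sum_sq_card_filter_mem_le M hr cf U
    simp only [S, P]
    exact_mod_cast this
  have hS0 : 0 ≤ S := le_trans (by positivity) hS
  clear_value S P n
  have h3 : S ^ 2 ≤ n * (r * (S + m * P)) := h1.trans (by gcongr)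
  have h4 : 2 * n * r * S ≤ S ^ 2 := by
    rw [sq]; gcongr; exact hUd.trans hS
  have h5 : (#U * d) ^ 2 ≤ S ^ 2 := by gcongr
  have h6 : 2 * n * r * m * P < (#U * d) ^ 2 := by
    have hq : 2 * n * r * m * (d ^ 2 / (2 * n * r * m)) = d ^ 2 :=
      mul_div_cancel₀ _ (by positivity)
    calc 2 * n * r * m * P < 2 * n * r * m * (#U * (#U * (d ^ 2 / (2 * n * r * m)))) :=
          mul_lt_mul_of_pos_left hP (by positivity)
      _ = #U * #U * (2 * n * r * m * (d ^ 2 / (2 * n * r * m))) := by ring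
      _ = (#U * d) ^ 2 := by rw [hq]; ring
  nlinarith

/-! ### Greedy selection of the branch vertices -/

/-- The invariant of the greedy selection, with `S` the branch vertices selected so far and `U` the
remaining candidates. All pairs and triples of vertices from `S` with at most one vertex replaced by
a candidate are admissible: pairs are light and non-adjacent with respect to `M`, and no three sets
`M x`, `M y`, `M z` have a common element. -/
structure IsSpread {V : Type*} [DecidableEq V] (M : V → Finset V) (m : ℕ) (S U : Finset V) :
    Prop where
  disj : Disjoint S U
  light : ∀ x ∈ S, ∀ y ∈ S ∪ U, x ≠ y → IsLight M m x y
  notMem : ∀ x ∈ S, ∀ y ∈ S ∪ U, y ∉ M x ∧ x ∉ M y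
  triple : ∀ x ∈ S, ∀ y ∈ S, x ≠ y → ∀ z ∈ S ∪ U, z ≠ x → z ≠ y → ∀ b ∈ M x ∩ M y, b ∉ M z

open Classical in
/-- Selecting the candidate `u` keeps as candidates its light partners in `U`, up to the at most
`(#S * m + 2) * D` vertices that would violate one of the other conditions. -/
theorem IsSpread.exists_insert {V : Type*} {M : V → Finset V} (hM : ∀ x, x ∉ M x) {m : ℕ}
    {S U : Finset V} (h : IsSpread M m S U) {u : V} (hu : u ∈ U) {D : ℝ}
    (hout : #(M u) ≤ D) (hin : ∀ b, #{a ∈ U | b ∈ M a} ≤ D) :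
    ∃ U' ⊆ U, IsSpread M m (insert u S) U' ∧
      (#{w ∈ U | IsLight M m u w} : ℝ) - (#S * m + 2) * D ≤ #U' := by
  have hD : 0 ≤ D := (Nat.cast_nonneg _).trans hout
  have huS : u ∉ S := fun hS ↦ Finset.disjoint_left.1 h.disj hS hu
  -- the candidates adjacent to `u`, and those in a triple intersection with `u` and some `x ∈ S`
  let Z := M u ∪ {w ∈ U | u ∈ M w} ∪
    S.biUnion fun x ↦ (M u ∩ M x).biUnion fun b ↦ {w ∈ U | b ∈ M w}
  have hZ : (#Z : ℝ) ≤ (#S * m + 2) * D := by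
    have h1 : (#(S.biUnion fun x ↦ (M u ∩ M x).biUnion fun b ↦ {w ∈ U | b ∈ M w}) : ℝ)
        ≤ #S * (m * D) := by
      have h2 : ∀ x ∈ S, (#((M u ∩ M x).biUnion fun b ↦ {w ∈ U | b ∈ M w}) : ℝ) ≤ m * D := by
        intro x hx
        have h3 : #(M u ∩ M x) ≤ m :=
          (h.light x hx u (mem_union_right _ hu) (by rintro rfl; exact huS hx)).symm.2.2.le
        calc (#((M u ∩ M x).biUnion fun b ↦ {w ∈ U | b ∈ M w}) : ℝ)
            ≤ ∑ b ∈ M u ∩ M x, (#{w ∈ U | b ∈ M w} : ℝ) := by exact_mod_cast card_biUnion_le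
          _ ≤ #(M u ∩ M x) • D := sum_le_card_nsmul _ _ _ fun b _ ↦ hin b
          _ ≤ m * D := by rw [nsmul_eq_mul]; gcongr
      calc _ ≤ ∑ x ∈ S, (#((M u ∩ M x).biUnion fun b ↦ {w ∈ U | b ∈ M w}) : ℝ) := by
            exact_mod_cast card_biUnion_le
        _ ≤ #S • (m * D) := sum_le_card_nsmul _ _ _ h2
        _ = _ := by rw [nsmul_eq_mul]
    have h4 : (#Z : ℝ) ≤ #(M u) + #{w ∈ U | u ∈ M w} +
        #(S.biUnion fun x ↦ (M u ∩ M x).biUnion fun b ↦ {w ∈ U | b ∈ M w}) := by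
      exact_mod_cast (card_union_le _ _).trans (Nat.add_le_add_right (card_union_le _ _) _)
    linarith [hin u]
  refine ⟨({w ∈ U | IsLight M m u w} : Finset V) \ Z, sdiff_subset.trans (filter_subset _ _),
    ?_, ?_⟩
  · have key : ∀ w, w ∈ ({w ∈ U | IsLight M m u w} : Finset V) \ Z →
        w ∈ U ∧ IsLight M m u w ∧ w ∉ M u ∧ u ∉ M w ∧
          ∀ x ∈ S, ∀ b ∈ M u, b ∈ M x → b ∉ M w := by
      intro w hw
      simp only [Z, mem_sdiff, mem_filter, mem_union, mem_biUnion, not_or, not_exists, not_and,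
        mem_inter] at hw
      obtain ⟨⟨hwU, hl⟩, ⟨h1, h2⟩, h3⟩ := hw
      exact ⟨hwU, hl, h1, h2 hwU, fun x hx b hb hbx ↦ h3 x hx b ⟨hb, hbx⟩ hwU⟩
    generalize ({w ∈ U | IsLight M m u w} : Finset V) \ Z = U' at key
    obtain ⟨hdisj, hl, hnm, htr⟩ := h
    simp only [mem_union, mem_inter] at hl hnm htr
    refine ⟨?_, ?_, ?_, ?_⟩
    · rw [Finset.disjoint_left] at hdisj ⊢
      intro a ha haU
      have := key a haU
      rcases mem_insert.1 ha with rfl | ha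
      · exact this.2.1.1 rfl
      · exact hdisj ha this.1
    · simp only [mem_union, mem_insert]
      rintro x (rfl | hx) y ((rfl | hy) | hy) hxy
      · exact absurd rfl hxy
      · exact (hl y hy x (.inr hu) hxy.symm).symm
      · exact (key y hy).2.1
      · exact hl x hx y (.inr hu) hxy
      · exact hl x hx y (.inl hy) hxy
      · exact hl x hx y (.inr (key y hy).1) hxy
    · simp only [mem_union, mem_insert]
      rintro x (rfl | hx) y ((rfl | hy) | hy)
      · exact ⟨hM _, hM _⟩
      · exact (hnm y hy x (.inr hu)).symm
      · exact ⟨(key y hy).2.2.1, (key y hy).2.2.2.1⟩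
      · exact hnm x hx y (.inr hu)
      · exact hnm x hx y (.inl hy)
      · exact hnm x hx y (.inr (key y hy).1)
    · simp only [mem_union, mem_insert, mem_inter]
      grind
  · have := le_card_sdiff Z ({w ∈ U | IsLight M m u w} : Finset V)
    have h5 : #{w ∈ U | IsLight M m u w} ≤ #(({w ∈ U | IsLight M m u w} : Finset V) \ Z) + #Z := by
      omega
    have h6 : (#{w ∈ U | IsLight M m u w} : ℝ)
        ≤ #(({w ∈ U | IsLight M m u w} : Finset V) \ Z) + #Z := by exact_mod_cast h5
    linarith

open Classical in
/-- Each step of the selection keeps at least a proportion `p / 2` of the candidates: a proportion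
`p` is light to the selected vertex, and by `hD` at most half of it is deleted. -/
theorem exists_isSpread {V : Type*} [Fintype V] (M : V → Finset V) (hM : ∀ x, x ∉ M x)
    {m r : ℕ} (hr : 0 < r) (hm : 0 < m) (cf : (codegreeGraph M m).CliqueFree (r + 1))
    (A : Finset V) (hA : A.Nonempty) {d D p : ℝ} (hd : 0 ≤ d) (hdM : ∀ u ∈ A, d ≤ #(M u))
    (hout : ∀ u ∈ A, #(M u) ≤ D) (hin : ∀ b, #{a ∈ A | b ∈ M a} ≤ D)
    (hp : 0 < p) (hp2 : p ≤ 2) (hpd : p ≤ d ^ 2 / (2 * Fintype.card V * r * m)) (t : ℕ)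
    (hD : (t * m + 2) * D ≤ #A * (p / 2) ^ t)
    (hAd : 2 * Fintype.card V * r ≤ #A * (p / 2) ^ t * d) :
    ∃ S ⊆ A, #S = t ∧ IsSpread M m S ∅ := by
  have hA0 : (0 : ℝ) < #A := by exact_mod_cast hA.card_pos
  have main : ∀ i ≤ t, ∃ S ⊆ A, ∃ U ⊆ A, #S = i ∧ IsSpread M m S U ∧
      #A * (p / 2) ^ i ≤ #U := by
    intro i
    induction i with
    | zero =>
      exact fun _ ↦ ⟨∅, empty_subset _, A, Subset.rfl, rfl, ⟨by simp, by simp, by simp, by simp⟩,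
        by simp⟩
    | succ i ih =>
      intro hi
      obtain ⟨S, hS, U, hUA, rfl, hSU, hU⟩ := ih (by omega)
      have hpow : (p / 2) ^ t ≤ (p / 2) ^ (#S + 1) :=
        pow_le_pow_of_le_one (by positivity) (by linarith) hi
      have hpow' : (p / 2) ^ t ≤ (p / 2) ^ #S :=
        pow_le_pow_of_le_one (by positivity) (by linarith) (by omega)
      have hU0 : U.Nonempty := by
        rw [← card_pos]
        have : (0 : ℝ) < #U := lt_of_lt_of_le (by positivity) hU
        exact_mod_cast this
      obtain ⟨u, hu, hlight⟩ := exists_card_isLight_ge M hr hm cf U hU0 hd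
        (fun u hu ↦ hdM u (hUA hu)) (hAd.trans (by gcongr; exact le_trans (by gcongr) hU))
      obtain ⟨U', hU', hspread, hcard⟩ := hSU.exists_insert hM hu (hout u (hUA hu)) (fun b ↦
        le_trans (by gcongr) (hin b))
      refine ⟨insert u S, insert_subset (hUA hu) hS, U', hU'.trans hUA, ?_, hspread, ?_⟩
      · exact card_insert_of_notMem fun hS ↦ Finset.disjoint_left.1 hSU.disj hS hu
      · have hD0 : 0 ≤ D := (Nat.cast_nonneg _).trans (hout u (hUA hu))
        have h1 : (#S * m + 2) * D ≤ #A * (p / 2) ^ (#S + 1) := by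
          refine le_trans ?_ (hD.trans (by gcongr))
          gcongr
          omega
        have h2 : #U * p ≤ #{w ∈ U | IsLight M m u w} := le_trans (by gcongr) hlight
        have h3 : #A * (p / 2) ^ (#S + 1) ≤ #U * (p / 2) := by
          rw [pow_succ, ← mul_assoc]; gcongr
        linarith
  obtain ⟨S, hS, U, -, hcard, h, -⟩ := main t le_rfl
  refine ⟨S, hS, hcard, ⟨by simp, ?_, ?_, ?_⟩⟩
  · exact fun x hx y hy ↦ h.light x hx y (mem_union_left _ (by simpa using hy))
  · exact fun x hx y hy ↦ h.notMem x hx y (mem_union_left _ (by simpa using hy))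
  · exact fun x hx y hy hxy z hz ↦ h.triple x hx y hy hxy z (mem_union_left _ (by simpa using hz))

/-- Any choice of an element of `M x ∩ M y` for each pair gives the subdividing vertices: two of
them differ as triple intersections are empty, and none is a branch vertex as branch vertices are
not adjacent. -/
theorem IsSpread.subdivision_isContained {V W : Type*} [DecidableEq V] {G : SimpleGraph V}
    {M : V → Finset V} (hMG : ∀ x, ∀ b ∈ M x, G.Adj x b) {m : ℕ} {S : Finset V}
    (h : IsSpread M m S ∅) (K : SimpleGraph W) (u : W → V) (hu : Function.Injective u)
    (huS : ∀ i, u i ∈ S) : K.subdivision ⊑ G := by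
  obtain ⟨-, hl, hnm, htr⟩ := h
  simp only [union_empty] at hl hnm htr
  have hex : ∀ e : K.edgeSet, ∃ b, ∀ w ∈ (e : Sym2 W), b ∈ M (u w) := by
    rintro ⟨e, he⟩
    induction e with | _ i j =>
    obtain ⟨b, hb⟩ := (hl _ (huS i) _ (huS j) (hu.ne (K.ne_of_adj he))).2.1
    exact ⟨b, by simpa using hb⟩
  choose y hy using hex
  refine SimpleGraph.subdivision_isContained u y hu ?_ ?_ fun w e hw ↦ hMG _ _ (hy e w hw)
  · rintro ⟨e, he⟩ ⟨f, hf⟩ hef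
    have h1 := hy ⟨e, he⟩
    have h2 := hy ⟨f, hf⟩
    rw [hef] at h1
    generalize y ⟨f, hf⟩ = b at h1 h2
    simp only at h1 h2
    induction e with | _ i j =>
    have hij : i ≠ j := K.ne_of_adj he
    have h3 : ∀ k ∈ f, k = i ∨ k = j := by
      intro k hk
      by_contra! hne
      exact htr _ (huS i) _ (huS j) (hu.ne hij) _ (huS k) (hu.ne hne.1) (hu.ne hne.2) b
        (mem_inter.2 ⟨h1 i (by simp), h1 j (by simp)⟩) (h2 k hk)
    induction f with | _ k l =>
    have hkl : k ≠ l := K.ne_of_adj hf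
    have hk := h3 k (by simp)
    have hl := h3 l (by simp)
    grind
  · rintro w ⟨e, he⟩ heq
    induction e with | _ i j =>
    exact (hnm _ (huS i) _ (huS w)).1 (heq ▸ hy ⟨_, he⟩ i (by simp))

/-! ### Graphs of large minimum degree -/

theorem exists_injective_mem {V W : Type*} [Fintype W] {T : Finset V}
    (hT : #T = Fintype.card W) : ∃ u : W → V, Function.Injective u ∧ ∀ i, u i ∈ T := by
  let e : W ≃ T := Fintype.equivOfCardEq (by simp [hT])
  exact ⟨fun i ↦ e i, Subtype.val_injective.comp e.injective, fun i ↦ (e i).2⟩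

open Classical in
/-- The combination of the two cases, with the size conditions on the minimum degree `δ`, the
in-degree threshold `D` and the density `p` of light pairs left explicit: `hbi` is what the double
counting needs, the conditions from `hp` on are for the greedy selection. -/
theorem subdivision_isContained_of_le_degree {V W : Type*} [Fintype V] [Nonempty V] [Fintype W]
    (G : SimpleGraph V) (K : SimpleGraph W) {δ : ℕ} (hδ : ∀ v, δ ≤ G.degree v)
    (hW : 2 ≤ Fintype.card W) (hWδ : 4 * Fintype.card W ≤ δ) {D p : ℝ} (hδD : δ ≤ D)
    (hbi : 2 * Fintype.card W ^ 2 * 4 ^ Fintype.card W *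
      (Fintype.card V / D) ^ Fintype.card W < Fintype.card V)
    (hp : 0 < p) (hp2 : p ≤ 2)
    (hpδ : 8 * Fintype.card V * Fintype.card W ^ 3 * p ≤ δ ^ 2)
    (hD : 2 * (Fintype.card W ^ 3 + 2) * D ≤ Fintype.card V * (p / 2) ^ Fintype.card W)
    (hpow : 8 * Fintype.card W ≤ (p / 2) ^ Fintype.card W * δ) :
    K.subdivision ⊑ G := by
  choose N hNG hNδ using fun v ↦ exists_subset_card_eq (hδ v)
  simp only [subset_iff, mem_neighborFinset] at hNG
  set n := Fintype.card V
  set t := Fintype.card W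
  have hn : (0 : ℝ) < n := by exact_mod_cast Fintype.card_pos
  have hδ0 : (0 : ℝ) < δ := by
    have : 0 < δ := by omega
    exact_mod_cast this
  have hD0 : 0 < D := hδ0.trans_le hδD
  -- the vertices of large in-degree
  let H : Finset V := {b | D < #{a | b ∈ N a}}
  have hH : #H * D ≤ n * δ := by
    have h1 := sum_card_bipartiteAbove_eq_sum_card_bipartiteBelow (s := (univ : Finset V))
      (t := (univ : Finset V)) (fun u b ↦ b ∈ N u)
    simp only [bipartiteAbove, bipartiteBelow, filter_univ_mem, hNδ, sum_const, card_univ,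
      smul_eq_mul] at h1
    calc #H * D = #H • D := (nsmul_eq_mul _ _).symm
      _ ≤ ∑ b ∈ H, (#{a | b ∈ N a} : ℝ) :=
        card_nsmul_le_sum _ _ _ fun b hb ↦ (mem_filter.1 hb).2.le
      _ ≤ ∑ b, (#{a | b ∈ N a} : ℝ) := sum_le_univ_sum_of_nonneg fun _ ↦ Nat.cast_nonneg _
      _ = n * δ := by exact_mod_cast h1.symm
  -- the vertices sending at least half of their chosen edges into `H`
  let B : Finset V := {v | δ ≤ 2 * #(N v ∩ H)}
  rcases le_total n (2 * #B) with hB | hB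
  · obtain ⟨T, -, hT, hTB⟩ := exists_powersetCard_le_card_superset N B H (k := (δ + 1) / 2)
      (m := t ^ 2) (t := t) (fun b hb ↦ by have := (mem_filter.1 hb).2; omega) (by
        have h1 : (δ : ℝ) / 4 ≤ ((δ + 1) / 2 + 1 - t : ℕ) := by
          have : δ ≤ 4 * ((δ + 1) / 2 + 1 - t) := by omega
          have : (δ : ℝ) ≤ 4 * ((δ + 1) / 2 + 1 - t : ℕ) := by exact_mod_cast this
          linarith
        have h2 : (#H : ℝ) ≤ n / D * δ := by
          rw [div_mul_eq_mul_div, le_div_iff₀ hD0]; exact hH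
        have h3 : (n : ℝ) ≤ 2 * #B := by exact_mod_cast hB
        have h4 : ((t ^ 2 * #H ^ t : ℕ) : ℝ) < ((#B * ((δ + 1) / 2 + 1 - t) ^ t : ℕ) : ℝ) := by
          push_cast
          calc (t : ℝ) ^ 2 * #H ^ t ≤ t ^ 2 * (n / D * δ) ^ t := by gcongr
            _ = (2 * t ^ 2 * 4 ^ t * (n / D) ^ t) * ((δ / 4) ^ t / 2) := by
              rw [mul_pow, div_pow (δ : ℝ)]; field_simp
            _ < n * ((δ / 4) ^ t / 2) := by gcongr
            _ ≤ 2 * #B * ((δ / 4) ^ t / 2) := by gcongr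
            _ = #B * (δ / 4) ^ t := by ring
            _ ≤ _ := by gcongr
        exact_mod_cast h4)
    obtain ⟨u, hu, huT⟩ := exists_injective_mem (W := W) hT
    refine subdivision_isContained_of_card_le_codegree K u hu fun i j _ ↦
      hTB.trans (card_le_card fun b hb ↦ ?_)
    have hb := (mem_filter.1 hb).2
    simp only [mem_filter, mem_univ, true_and]
    exact ⟨(hNG b (hb (huT i))).symm, (hNG b (hb (huT j))).symm⟩
  · let M : V → Finset V := fun v ↦ N v \ H
    have hMG : ∀ x, ∀ b ∈ M x, G.Adj x b := fun x b hb ↦ hNG x (mem_sdiff.1 hb).1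
    by_cases cf : (codegreeGraph M (t ^ 2)).CliqueFree (t - 1 + 1)
    · have hA : (n : ℝ) / 2 ≤ #Bᶜ := by
        have : n ≤ 2 * #Bᶜ := by
          have := card_compl B
          have := card_le_univ B
          omega
        have : (n : ℝ) ≤ 2 * #Bᶜ := by exact_mod_cast this
        linarith
      have ht1 : ((t - 1 : ℕ) : ℝ) ≤ t := by exact_mod_cast Nat.sub_le _ _
      have ht0 : (0 : ℝ) < ((t - 1 : ℕ) : ℝ) := by
        have : 0 < t - 1 := by omega
        exact_mod_cast this
      have htpos : (0 : ℝ) < t := ht0.trans_le ht1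
      obtain ⟨S, -, hSt, hS⟩ := exists_isSpread M
        (fun x hx ↦ G.loopless.irrefl x (hMG x x hx)) (r := t - 1) (m := t ^ 2)
        (by omega) (by positivity) cf Bᶜ
        (by
          rw [← card_pos]
          have : (0 : ℝ) < #Bᶜ := lt_of_lt_of_le (by positivity) hA
          exact_mod_cast this)
        (d := δ / 2) (D := D) (p := p) (by positivity)
        (by
          intro u hu
          have h1 : ¬ δ ≤ 2 * #(N u ∩ H) := by simpa [B] using hu
          have h2 := card_sdiff_add_card_inter (N u) H
          rw [hNδ] at h2
          have h3 : δ ≤ 2 * #(M u) := by simp only [M]; omega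
          have h4 : (δ : ℝ) ≤ 2 * #(M u) := by exact_mod_cast h3
          linarith)
        (fun u _ ↦ le_trans (by exact_mod_cast (card_le_card sdiff_subset).trans (hNδ u).le) hδD)
        (by
          intro b
          by_cases hb : b ∈ H
          · simp [M, hb, hD0.le]
          · have h1 : (#{a | b ∈ N a} : ℝ) ≤ D := by simpa [H] using hb
            refine le_trans ?_ h1
            exact_mod_cast card_le_card fun a ha ↦ by
              simp only [M, mem_filter, mem_sdiff] at ha
              simpa using ha.2.1)
        hp hp2
        (by
          rw [le_div_iff₀ (by positivity)]
          push_cast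
          calc p * (2 * n * ((t - 1 : ℕ) : ℝ) * t ^ 2) ≤ p * (2 * n * t * t ^ 2) := by gcongr
            _ = (8 * n * t ^ 3 * p) / 4 := by ring
            _ ≤ δ ^ 2 / 4 := by gcongr
            _ = (δ / 2) ^ 2 := by ring)
        t
        (by
          push_cast
          calc ((t : ℝ) * t ^ 2 + 2) * D = (2 * (t ^ 3 + 2) * D) / 2 := by ring
            _ ≤ (n * (p / 2) ^ t) / 2 := by gcongr
            _ = n / 2 * (p / 2) ^ t := by ring
            _ ≤ _ := by gcongr)
        (by
          calc 2 * n * ((t - 1 : ℕ) : ℝ) ≤ 2 * n * t := by gcongr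
            _ = n / 4 * (8 * t) := by ring
            _ ≤ n / 4 * ((p / 2) ^ t * δ) := by gcongr
            _ = n / 2 * (p / 2) ^ t * (δ / 2) := by ring
            _ ≤ _ := by gcongr)
      obtain ⟨u, hu, huS⟩ := exists_injective_mem (W := W) hSt
      exact hS.subdivision_isContained hMG K u hu huS
    · simp only [CliqueFree, not_forall, not_not] at cf
      obtain ⟨T, hT⟩ := cf
      obtain ⟨u, hu, huT⟩ := exists_injective_mem (W := W) (hT.card_eq.trans (by omega))
      refine subdivision_isContained_of_card_le_codegree K u hu fun i j hij ↦ ?_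
      refine (hT.isClique (huT i) (huT j) (hu.ne hij)).2.trans (card_le_card fun b hb ↦ ?_)
      rw [mem_inter] at hb
      simpa using ⟨hMG _ b hb.1, hMG _ b hb.2⟩

open Classical Filter in
/-- The choice of the parameters in `subdivision_isContained_of_le_degree`. -/
theorem exists_eventually_subdivision_isContained {W : Type*} [Fintype W] (K : SimpleGraph W)
    (hW : 2 ≤ Fintype.card W) {ε : ℝ} (hε : 0 ≤ ε) (hεW : ε ≤ 1 / (24 * Fintype.card W ^ 2)) :
    ∃ c : ℝ, ∀ᶠ n : ℕ in atTop, ∀ G : SimpleGraph (Fin n),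
      (∀ v, c * (n : ℝ) ^ (1 / 2 - ε) ≤ G.degree v) → K.subdivision ⊑ G := by
  set t := Fintype.card W
  have ht : (2 : ℝ) ≤ t := by exact_mod_cast hW
  have hev : ∀ (C a : ℝ), 0 < a → ∀ᶠ n : ℕ in atTop, C < (n : ℝ) ^ a := fun C a ha ↦
    ((tendsto_rpow_atTop ha).comp tendsto_natCast_atTop_atTop).eventually_gt_atTop C
  -- In terms of the unit `s` of the exponents, `D = n^(1 - 6s)` and `n^(-s) ≤ p^t`, so that the
  -- number of candidates exceeds `D` by a factor of order `n^(5s)`.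
  set s : ℝ := 1 / (12 * t)
  have hs : 0 < s := by positivity
  have hst : t * s = 1 / 12 := by simp only [s]; field_simp
  have hs24 : s ≤ 1 / 24 := by nlinarith
  have hεt : 2 * ε * t ≤ s := by
    calc 2 * ε * t ≤ 2 * (1 / (24 * t ^ 2)) * t := by gcongr
      _ = s := by simp only [s]; field_simp; norm_num
  have hεs : 4 * ε ≤ s := by nlinarith
  clear_value s
  -- `c = 8 t³` satisfies `8 t³ ≤ c²`, as the hypothesis `hpδ` requires for `p = n^(-2ε)`
  refine ⟨8 * t ^ 3, ?_⟩
  filter_upwards [eventually_gt_atTop 0, hev (2 * t ^ 2 * 4 ^ t) (1 / 2) (by norm_num),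
    hev (2 * (t ^ 3 + 2) * 2 ^ t) (5 * s) (by positivity),
    hev (8 * t * 2 ^ t) (1 / 4) (by norm_num),
    hev (8 * t ^ 3 + 1) (1 / 4) (by norm_num)] with n hn0 h1 h2 h3 h4 G hG
  have hn : (0 : ℝ) < n := by exact_mod_cast hn0
  have hn1 : (1 : ℝ) ≤ n := by exact_mod_cast hn0
  have : Nonempty (Fin n) := ⟨⟨0, hn0⟩⟩
  have ht3 : (8 : ℝ) ≤ t ^ 3 := by
    calc (8 : ℝ) = 2 ^ 3 := by norm_num
      _ ≤ _ := by gcongr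
  set δ : ℕ := ⌈8 * t ^ 3 * (n : ℝ) ^ (1 / 2 - ε)⌉₊
  have hδ : 8 * t ^ 3 * (n : ℝ) ^ (1 / 2 - ε) ≤ δ := Nat.le_ceil _
  have hone : ∀ {a : ℝ}, 0 ≤ a → 1 ≤ (n : ℝ) ^ a := fun ha ↦ Real.one_le_rpow hn1 ha
  have hmono : ∀ {a b : ℝ}, a ≤ b → (n : ℝ) ^ a ≤ (n : ℝ) ^ b :=
    fun h ↦ Real.rpow_le_rpow_of_exponent_le hn1 h
  have hp : (n : ℝ) ^ (-s) / 2 ^ t ≤ ((n : ℝ) ^ (-(2 * ε)) / 2) ^ t := by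
    rw [div_pow, ← Real.rpow_mul_natCast hn.le]
    gcongr ?_ / _
    exact hmono (by linarith)
  refine subdivision_isContained_of_le_degree G K (δ := δ) (D := (n : ℝ) ^ (1 - 6 * s))
    (p := (n : ℝ) ^ (-(2 * ε))) (fun v ↦ Nat.ceil_le.2 (hG v)) hW ?_ ?_ ?_ (by positivity) ?_ ?_
    ?_ ?_
  · have : (4 * t : ℝ) ≤ δ := by
      refine le_trans ?_ hδ
      have := hone (a := 1 / 2 - ε) (by linarith)
      calc (4 * t : ℝ) ≤ 8 * t ^ 3 * 1 := by nlinarith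
        _ ≤ _ := by gcongr
    exact_mod_cast this
  · calc (δ : ℝ) ≤ 8 * t ^ 3 * (n : ℝ) ^ (1 / 2 - ε) + 1 := (Nat.ceil_lt_add_one (by positivity)).le
      _ ≤ 8 * t ^ 3 * (n : ℝ) ^ (1 / 2 : ℝ) + (n : ℝ) ^ (1 / 2 : ℝ) := by
        have h5 := hmono (show 1 / 2 - ε ≤ 1 / 2 by linarith)
        have h6 := hone (a := 1 / 2) (by norm_num)
        gcongr
      _ = (8 * t ^ 3 + 1) * (n : ℝ) ^ (1 / 2 : ℝ) := by ring
      _ ≤ (n : ℝ) ^ (1 / 4 : ℝ) * (n : ℝ) ^ (1 / 2 : ℝ) := by gcongr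
      _ = (n : ℝ) ^ (1 / 4 + 1 / 2 : ℝ) := (Real.rpow_add hn _ _).symm
      _ ≤ _ := hmono (by linarith)
  · simp only [Fintype.card_fin]
    have h5 : ((n : ℝ) / (n : ℝ) ^ (1 - 6 * s)) ^ t = (n : ℝ) ^ (1 / 2 : ℝ) := by
      have h6 := Real.rpow_sub hn 1 (1 - 6 * s)
      rw [Real.rpow_one] at h6
      rw [← h6, ← Real.rpow_mul_natCast hn.le]
      congr 1
      linarith
    rw [h5]
    calc _ < (n : ℝ) ^ (1 / 2 : ℝ) * (n : ℝ) ^ (1 / 2 : ℝ) := by gcongr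
      _ = n := by rw [← Real.rpow_add hn]; norm_num
  · exact (Real.rpow_le_one_of_one_le_of_nonpos hn1 (by linarith)).trans (by norm_num)
  · simp only [Fintype.card_fin]
    calc 8 * n * t ^ 3 * (n : ℝ) ^ (-(2 * ε)) = 8 * t ^ 3 * ((n : ℝ) ^ (1 / 2 - ε)) ^ 2 := by
          rw [← Real.rpow_mul_natCast hn.le, show (1 / 2 - ε) * ((2 : ℕ) : ℝ) = 1 + -(2 * ε) by
            push_cast; ring, Real.rpow_add hn, Real.rpow_one]
          ring
      _ ≤ (8 * t ^ 3) ^ 2 * ((n : ℝ) ^ (1 / 2 - ε)) ^ 2 := by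
        gcongr; nlinarith
      _ = (8 * t ^ 3 * (n : ℝ) ^ (1 / 2 - ε)) ^ 2 := by ring
      _ ≤ _ := by gcongr
  · simp only [Fintype.card_fin]
    calc 2 * ((t : ℝ) ^ 3 + 2) * (n : ℝ) ^ (1 - 6 * s)
        = 2 * ((t : ℝ) ^ 3 + 2) * 2 ^ t * ((n : ℝ) ^ (1 - 6 * s) / 2 ^ t) := by field_simp
      _ ≤ (n : ℝ) ^ (5 * s) * ((n : ℝ) ^ (1 - 6 * s) / 2 ^ t) := by gcongr
      _ = n * ((n : ℝ) ^ (-s) / 2 ^ t) := by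
        rw [← mul_div_assoc, ← mul_div_assoc, ← Real.rpow_add hn,
          ← Real.rpow_one_add' hn.le (by linarith)]
        ring_nf
      _ ≤ _ := by gcongr
  · calc (8 * t : ℝ) = 8 * t * 2 ^ t / 2 ^ t := by field_simp
      _ ≤ (n : ℝ) ^ (1 / 4 : ℝ) / 2 ^ t := by gcongr
      _ ≤ (n : ℝ) ^ (-s + (1 / 2 - ε)) / 2 ^ t := by
        gcongr ?_ / _
        exact hmono (by linarith)
      _ = (n : ℝ) ^ (-s) / 2 ^ t * (1 * (n : ℝ) ^ (1 / 2 - ε)) := by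
        rw [Real.rpow_add hn]; ring
      _ ≤ (n : ℝ) ^ (-s) / 2 ^ t * (8 * t ^ 3 * (n : ℝ) ^ (1 / 2 - ε)) := by
        gcongr; linarith
      _ ≤ _ := by gcongr

/-! ### From minimum degree to the number of edges -/

open Classical Filter in
/-- A condition on the minimum degree of large graphs bounds the extremal number: delete a vertex of
small degree and induct, using `(n + 1) ^ α - n ^ α ≥ (n + 1) ^ (α - 1)`. -/
theorem exists_extremalNumber_le_rpow {W : Type*} (H : SimpleGraph W) {α c : ℝ} (hα : 1 ≤ α)
    (hH : ∀ᶠ n : ℕ in atTop, ∀ G : SimpleGraph (Fin n),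
      (∀ v, c * (n : ℝ) ^ (α - 1) ≤ G.degree v) → H ⊑ G) :
    ∃ C : ℝ, ∀ n : ℕ, (extremalNumber n H : ℝ) ≤ C * (n : ℝ) ^ α := by
  obtain ⟨n₀, hn₀⟩ := eventually_atTop.1 hH
  set C : ℝ := max c n₀
  have hC : 0 ≤ C := (Nat.cast_nonneg n₀).trans (le_max_right _ _)
  refine ⟨C, fun n ↦ ?_⟩
  induction n with
  | zero =>
    rw [← Fintype.card_fin 0, extremalNumber_le_iff_of_nonneg _ (by positivity)]
    intro G _ _
    have : #G.edgeFinset = 0 := by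
      have := G.card_edgeFinset_le_card_choose_two
      simpa using this
    rw [this, Nat.cast_zero]
    positivity
  | succ n ih =>
    have hpos : (0 : ℝ) < (n + 1 : ℕ) := by positivity
    have hone : (1 : ℝ) ≤ (n + 1 : ℕ) := by exact_mod_cast Nat.le_add_left 1 n
    have hsplit : ((n + 1 : ℕ) : ℝ) ^ α = (n + 1 : ℕ) * ((n + 1 : ℕ) : ℝ) ^ (α - 1) := by
      rw [Real.rpow_sub_one hpos.ne']; field_simp
    rw [← Fintype.card_fin (n + 1), extremalNumber_le_iff_of_nonneg _ (by positivity),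
      Fintype.card_fin]
    intro G _ hG
    rcases lt_or_ge (n + 1) n₀ with hlt | hge
    · have h1 : #G.edgeFinset ≤ n₀ * (n + 1) := by
        refine G.card_edgeFinset_le_card_choose_two.trans ((Nat.choose_le_pow _ _).trans ?_)
        rw [Fintype.card_fin, sq]
        gcongr
      calc (#G.edgeFinset : ℝ) ≤ n₀ * (n + 1 : ℕ) := by exact_mod_cast h1
        _ ≤ C * (n + 1 : ℕ) := by gcongr; exact le_max_right _ _
        _ ≤ _ := by
          gcongr
          exact Real.self_le_rpow_of_one_le hone hα
    · have : ∃ v, (G.degree v : ℝ) < c * ((n + 1 : ℕ) : ℝ) ^ (α - 1) := by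
        by_contra! hcon
        exact hG (hn₀ (n + 1) hge G fun v ↦ by convert! hcon v)
      obtain ⟨v, hv⟩ := this
      have h1 := card_edgeFinset_deleteIncidenceSet_le_extremalNumber hG v
      rw [card_edgeFinset_deleteIncidenceSet, Fintype.card_fin, Nat.add_sub_cancel] at h1
      have h2 : (#G.edgeFinset : ℝ) ≤ extremalNumber n H + G.degree v := by
        have : #G.edgeFinset ≤ extremalNumber n H + G.degree v := by omega
        exact_mod_cast this
      have h3 : (n : ℝ) ^ α ≤ n * ((n + 1 : ℕ) : ℝ) ^ (α - 1) := by
        rcases n.eq_zero_or_pos with rfl | hn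
        · simp [Real.zero_rpow (by linarith : α ≠ 0)]
        · have hn' : (0 : ℝ) < n := by exact_mod_cast hn
          calc (n : ℝ) ^ α = n * (n : ℝ) ^ (α - 1) := by
                rw [Real.rpow_sub_one hn'.ne']; field_simp
            _ ≤ _ := by gcongr; omega
      calc (#G.edgeFinset : ℝ)
          ≤ C * (n * ((n + 1 : ℕ) : ℝ) ^ (α - 1)) + C * ((n + 1 : ℕ) : ℝ) ^ (α - 1) := by
            refine h2.trans (add_le_add (ih.trans (by gcongr)) (hv.le.trans ?_))
            gcongr
            exact le_max_left _ _
        _ = _ := by rw [hsplit]; push_cast; ring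

end SimpleGraph

theorem theorem5p1 (t : ℕ) (ht : 3 ≤ t) :
    ∃ C : ℝ, ∀ n : ℕ,
      (SimpleGraph.extremalNumber n (SimpleGraph.subdivision (SimpleGraph.completeGraph (Fin t))) : ℝ)
        ≤ C * (n : ℝ) ^ ((3 : ℝ) / 2 - 1 / (6 : ℝ) ^ t) := by
  have hpow : 24 * t ^ 2 ≤ 6 ^ t := by
    induction t, ht using Nat.le_induction with
    | base => norm_num
    | succ k hk ih => rw [pow_succ 6]; nlinarith
  have hε : 1 / (6 : ℝ) ^ t ≤ 1 / (24 * t ^ 2) := by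
    have : (24 * t ^ 2 : ℝ) ≤ 6 ^ t := by exact_mod_cast hpow
    gcongr
  obtain ⟨c, h⟩ := SimpleGraph.exists_eventually_subdivision_isContained
    (SimpleGraph.completeGraph (Fin t)) (by simp; omega) (ε := 1 / (6 : ℝ) ^ t) (by positivity)
    (by simpa using hε)
  have h6 : 1 / (6 : ℝ) ^ t ≤ 1 / 2 := by
    have : (6 : ℝ) ^ 1 ≤ 6 ^ t := pow_le_pow_right₀ (by norm_num) (by omega)
    gcongr
    linarith
  refine SimpleGraph.exists_extremalNumber_le_rpow _ (c := c) (by linarith) ?_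
  convert h using 8
  ring
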